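/- Let $H$ be an infinite-dimensional separable complex Hilbert space, and let $K(H)\subseteq B(H)$ be the ideal of compact operators. For C$^*$-algebras and $*$-homomorphisms $\phi_A:D\to A$, $\phi_B:D\to B$, let $A*_DB$ denote the full amalgamated free product: the C$^*$-algebra generated by images of $A$ and $B$ under $*$-homomorphisms $\sigma_A,\sigma_B$ with $\sigma_A\circ\phi_A=\sigma_B\circ\phi_B$, such that any pair of $*$-homomorphisms $\pi_A:A\to C$, $\pi_B:B\to C$ into a C$^*$-algebra $C$ with $\pi_A\circ\phi_A=\pi_B\circ\phi_B$ is of the form $\pi_A=\pi\circ\sigma_A$, $\pi_B=\pi\circ\sigma_B$ for a $*$-homomorphism $\pi:A*_DB\to C$. Inside $B(H)$, let $D=\mathbb{C}1$ and $A=B=\mathbb{C}1+K(H)$. For a unitary $u\in B(H)$, let $\tilde D=C^*(u)$ and $\tilde A=\tilde B=\tilde D+K(H)$, and let $\lambda:A*_DB\to\tilde A*_{\tilde D}\tilde B$ be the $*$-homomorphism that arises, through the universal property, from the inclusions $A\subseteq\tilde A$, $B\subseteq\tilde B$ and $D\subseteq\tilde D$ (all free products being taken with respect to the inclusions). (1)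 For every unitary $u\in B(H)$ that does not belong to $\mathbb{C}1$, the map $\lambda$ is not injective. (2) There is a unitary $u\in B(H)$, not belonging to $\mathbb{C}1$, such that $A\cap\tilde D=D=B\cap\tilde D$. -/

import Mathlib

noncomputable section

/-- A C⋆-seminorm on a complex ⋆-algebra. -/
structure CStarSeminorm (F : Type*) [NonUnitalRing F] [StarRing F] [Module ℂ F] extends
    Seminorm ℂ F where
  mul_le' : ∀ x y, toFun (x * y) ≤ toFun x * toFun y
  star_mul_self' : ∀ x, toFun (star x * x) = toFun x * toFun x

namespace CStarSeminorm

section Basic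

variable {F : Type*} [NonUnitalRing F] [StarRing F] [Module ℂ F]

theorem mul_le (p : CStarSeminorm F) (x y : F) :
    p.toSeminorm (x * y) ≤ p.toSeminorm x * p.toSeminorm y := p.mul_le' x y

theorem star_mul_self (p : CStarSeminorm F) (x : F) :
    p.toSeminorm (star x * x) = p.toSeminorm x * p.toSeminorm x := p.star_mul_self' x

theorem le_star (p : CStarSeminorm F) (x : F) : p.toSeminorm x ≤ p.toSeminorm (star x) := by
  rcases (apply_nonneg p.toSeminorm x).eq_or_lt with h | h
  · rw [← h]; exact apply_nonneg _ _
  · refine le_of_mul_le_mul_right ?_ h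
    rw [← p.star_mul_self]
    exact p.mul_le _ _

theorem map_star (p : CStarSeminorm F) (x : F) : p.toSeminorm (star x) = p.toSeminorm x :=
  le_antisymm (by simpa using p.le_star (star x)) (p.le_star x)

/-- The ⋆-algebra `F`, regarded as a seminormed ⋆-algebra through `p`. -/
def Pre (_p : CStarSeminorm F) : Type _ := F

variable (p : CStarSeminorm F)

instance : NonUnitalRing p.Pre := inferInstanceAs (NonUnitalRing F)
instance : StarRing p.Pre := inferInstanceAs (StarRing F)
instance : Module ℂ p.Pre := inferInstanceAs (Module ℂ F)
instance [IsScalarTower ℂ F F] : IsScalarTower ℂ p.Pre p.Pre :=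
  inferInstanceAs (IsScalarTower ℂ F F)
instance [SMulCommClass ℂ F F] : SMulCommClass ℂ p.Pre p.Pre :=
  inferInstanceAs (SMulCommClass ℂ F F)
instance [StarModule ℂ F] : StarModule ℂ p.Pre := inferInstanceAs (StarModule ℂ F)

instance : NonUnitalSeminormedRing p.Pre where
  __ := (inferInstance : NonUnitalRing p.Pre)
  __ := AddGroupSeminorm.toSeminormedAddCommGroup (E := F) p.toSeminorm.toAddGroupSeminorm
  norm_mul_le := p.mul_le'

theorem norm_def (x : p.Pre) : ‖x‖ = p.toSeminorm x := rfl

instance : NormedSpace ℂ p.Pre where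
  norm_smul_le c x := (map_smul_eq_mul p.toSeminorm c x).le

/-- The separated completion of `F` with respect to the C⋆-seminorm `p`. -/
def Completion : Type _ := UniformSpace.Completion p.Pre

end Basic

section CompletionInstances

variable {F : Type*} [NonUnitalRing F] [StarRing F] [Module ℂ F] (p : CStarSeminorm F)

instance : NormedAddCommGroup p.Completion :=
  inferInstanceAs (NormedAddCommGroup (UniformSpace.Completion p.Pre))
instance : Module ℂ p.Completion :=
  inferInstanceAs (Module ℂ (UniformSpace.Completion p.Pre))
instance : CompleteSpace p.Completion :=
  inferInstanceAs (CompleteSpace (UniformSpace.Completion p.Pre))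

/-- The canonical linear map from `F` to its completion. -/
def coe : F →ₗ[ℂ] p.Completion where
  toFun x := ((show p.Pre from x) : UniformSpace.Completion p.Pre)
  map_add' x y := UniformSpace.Completion.coe_add (α := p.Pre) x y
  map_smul' c x := UniformSpace.Completion.coe_smul (X := p.Pre) c x

/-- The same map on the seminormed space `p.Pre`. -/
def coe' (x : p.Pre) : p.Completion := p.coe x

theorem norm_coe (x : F) : ‖p.coe x‖ = p.toSeminorm x :=
  UniformSpace.Completion.norm_coe (E := p.Pre) x

theorem isDenseInducing_coe' : IsDenseInducing p.coe' :=
  UniformSpace.Completion.isDenseInducing_coe (α := p.Pre)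

theorem continuous_coe' : Continuous p.coe' := p.isDenseInducing_coe'.continuous

@[elab_as_elim]
theorem induction_on {P : p.Completion → Prop} (x : p.Completion) (hc : IsClosed {x | P x})
    (h : ∀ x : F, P (p.coe x)) : P x :=
  UniformSpace.Completion.induction_on (α := p.Pre) x hc h

@[elab_as_elim]
theorem induction_on₂ {P : p.Completion → p.Completion → Prop} (x y : p.Completion)
    (hc : IsClosed {x : p.Completion × p.Completion | P x.1 x.2})
    (h : ∀ x y : F, P (p.coe x) (p.coe y)) : P x y :=
  UniformSpace.Completion.induction_on₂ (α := p.Pre) (β := p.Pre) x y hc h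

@[elab_as_elim]
theorem induction_on₃ {P : p.Completion → p.Completion → p.Completion → Prop}
    (x y z : p.Completion)
    (hc : IsClosed {x : p.Completion × p.Completion × p.Completion | P x.1 x.2.1 x.2.2})
    (h : ∀ x y z : F, P (p.coe x) (p.coe y) (p.coe z)) : P x y z :=
  UniformSpace.Completion.induction_on₃ (α := p.Pre) (β := p.Pre) (γ := p.Pre) x y z hc h

instance : Mul p.Completion :=
  ⟨Function.curry <| (p.isDenseInducing_coe'.prodMap p.isDenseInducing_coe').extend
    (p.coe' ∘ Function.uncurry (· * ·))⟩

theorem coe_mul (x y : F) : p.coe (x * y) = p.coe x * p.coe y :=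
  ((p.isDenseInducing_coe'.prodMap p.isDenseInducing_coe').extend_eq
    (p.continuous_coe'.comp (continuous_mul (M := p.Pre))) (x, y)).symm

instance : ContinuousMul p.Completion where
  continuous_mul := by
    let i : p.Pre →+ p.Completion := p.coe.toAddMonoidHom
    let m := (AddMonoidHom.mul : p.Pre →+ p.Pre →+ p.Pre).compr₂ i
    have : Continuous fun q : p.Pre × p.Pre => m q.1 q.2 :=
      p.continuous_coe'.comp continuous_mul
    have di : IsDenseInducing i := p.isDenseInducing_coe'
    exact (di.extend_Z_bilin di this :)

instance : Star p.Completion :=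
  ⟨UniformSpace.Completion.map (α := p.Pre) (β := p.Pre) star⟩

theorem isometry_star : Isometry (star : p.Pre → p.Pre) := by
  refine Isometry.of_dist_eq fun x y => ?_
  rw [dist_eq_norm, dist_eq_norm, ← star_sub]
  exact p.map_star _

theorem coe_star (x : F) : p.coe (star x) = star (p.coe x) :=
  (UniformSpace.Completion.map_coe p.isometry_star.uniformContinuous x).symm

instance : ContinuousStar p.Completion where
  continuous_star := UniformSpace.Completion.continuous_map (α := p.Pre) (β := p.Pre)

theorem completion_zero_mul (a : p.Completion) : 0 * a = 0 := by
  induction a using p.induction_on with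
  | hc => exact isClosed_eq (by fun_prop) (by fun_prop)
  | h a => rw [← _root_.map_zero p.coe, ← coe_mul, zero_mul]

theorem completion_mul_zero (a : p.Completion) : a * 0 = 0 := by
  induction a using p.induction_on with
  | hc => exact isClosed_eq (by fun_prop) (by fun_prop)
  | h a => rw [← _root_.map_zero p.coe, ← coe_mul, mul_zero]

theorem completion_mul_assoc (a b c : p.Completion) : a * b * c = a * (b * c) := by
  induction a, b, c using p.induction_on₃ with
  | hc => exact isClosed_eq (by fun_prop) (by fun_prop)
  | h a b c => simp only [← coe_mul, mul_assoc]

theorem completion_mul_add (a b c : p.Completion) : a * (b + c) = a * b + a * c := by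
  induction a, b, c using p.induction_on₃ with
  | hc => exact isClosed_eq (by fun_prop) (by fun_prop)
  | h a b c => simp only [← coe_mul, ← map_add, mul_add]

theorem completion_add_mul (a b c : p.Completion) : (a + b) * c = a * c + b * c := by
  induction a, b, c using p.induction_on₃ with
  | hc => exact isClosed_eq (by fun_prop) (by fun_prop)
  | h a b c => simp only [← coe_mul, ← map_add, add_mul]

theorem completion_norm_mul_le (a b : p.Completion) : ‖a * b‖ ≤ ‖a‖ * ‖b‖ := by
  induction a, b using p.induction_on₂ with
  | hc => exact isClosed_le (by fun_prop) (by fun_prop)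
  | h a b => simpa only [← coe_mul, norm_coe] using p.mul_le a b

instance : NonUnitalNormedRing p.Completion where
  __ := (inferInstance : NormedAddCommGroup p.Completion)
  __ := (inferInstance : Mul p.Completion)
  zero_mul := p.completion_zero_mul
  mul_zero := p.completion_mul_zero
  mul_assoc := p.completion_mul_assoc
  left_distrib := p.completion_mul_add
  right_distrib := p.completion_add_mul
  norm_mul_le := p.completion_norm_mul_le

instance : NormedSpace ℂ p.Completion where
  norm_smul_le := norm_smul_le (α := ℂ) (β := UniformSpace.Completion p.Pre)

instance : ContinuousStar p.Completion where
  continuous_star := UniformSpace.Completion.continuous_map (α := p.Pre) (β := p.Pre)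

instance : StarRing p.Completion where
  star_involutive a := by
    induction a using p.induction_on with
    | hc => exact isClosed_eq (by fun_prop) (by fun_prop)
    | h a => simp only [← coe_star, star_star]
  star_mul a b := by
    induction a, b using p.induction_on₂ with
    | hc => exact isClosed_eq (by fun_prop) (by fun_prop)
    | h a b => simp only [← coe_star, ← coe_mul, star_mul]
  star_add a b := by
    induction a, b using p.induction_on₂ with
    | hc => exact isClosed_eq (by fun_prop) (by fun_prop)
    | h a b => simp only [← coe_star, ← map_add, star_add]

instance : CStarRing p.Completion where
  norm_mul_self_le a := by
    induction a using p.induction_on with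
    | hc => exact isClosed_le (by fun_prop) (by fun_prop)
    | h a => simp only [← coe_star, ← coe_mul, norm_coe, p.star_mul_self, le_refl]

instance [IsScalarTower ℂ F F] : IsScalarTower ℂ p.Completion p.Completion where
  smul_assoc c a b := by
    induction a, b using p.induction_on₂ with
    | hc =>
      exact isClosed_eq ((continuous_fst.const_smul c).mul continuous_snd)
            ((continuous_fst.mul continuous_snd).const_smul c)
    | h a b => simp only [smul_eq_mul, ← coe_mul, ← map_smul, smul_mul_assoc]

instance [SMulCommClass ℂ F F] : SMulCommClass ℂ p.Completion p.Completion where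
  smul_comm c a b := by
    induction a, b using p.induction_on₂ with
    | hc =>
      exact isClosed_eq ((continuous_fst.mul continuous_snd).const_smul c)
            (continuous_fst.mul (continuous_snd.const_smul c))
    | h a b => simp only [smul_eq_mul, ← coe_mul, ← map_smul, mul_smul_comm]

instance [StarModule ℂ F] : StarModule ℂ p.Completion where
  star_smul c a := by
    induction a using p.induction_on with
    | hc => exact isClosed_eq (continuous_id.const_smul c).star (continuous_star.const_smul (star c))
    | h a => simp only [← coe_star, ← map_smul, star_smul]

instance [IsScalarTower ℂ F F] [SMulCommClass ℂ F F] [StarModule ℂ F] :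
    NonUnitalCStarAlgebra p.Completion where

set_option linter.unusedSectionVars false

variable [IsScalarTower ℂ F F] [SMulCommClass ℂ F F] [StarModule ℂ F]

/-- The canonical ⋆-homomorphism from `F` to its completion. -/
def toCompletion : F →⋆ₙₐ[ℂ] p.Completion where
  toFun := p.coe
  map_smul' := map_smul p.coe
  map_zero' := map_zero p.coe
  map_add' := map_add p.coe
  map_mul' := p.coe_mul
  map_star' := p.coe_star

theorem norm_toCompletion (x : F) : ‖p.toCompletion x‖ = p.toSeminorm x := p.norm_coe x

theorem denseRange_toCompletion : DenseRange p.toCompletion := p.isDenseInducing_coe'.dense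

variable {C : Type*} [NonUnitalCStarAlgebra C]

/-- The C⋆-seminorm `x ↦ ‖f x‖` for a ⋆-homomorphism `f` into a C⋆-algebra. -/
def ofHom (f : F →⋆ₙₐ[ℂ] C) : CStarSeminorm F where
  toFun x := ‖f x‖
  map_zero' := by simp
  add_le' x y := by simpa using norm_add_le (f x) (f y)
  neg' x := by simp
  smul' c x := by simp [norm_smul]
  mul_le' x y := by simpa using norm_mul_le (f x) (f y)
  star_mul_self' x := by
    simp only [_root_.map_mul, StarHomClass.map_star]
    exact CStarRing.norm_star_mul_self (x := f x)

theorem ofHom_apply (f : F →⋆ₙₐ[ℂ] C) (x : F) : (ofHom f).toSeminorm x = ‖f x‖ := rfl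

variable {p} in
theorem uniformContinuous_of_le {f : F →⋆ₙₐ[ℂ] C} (hf : ∀ x, ‖f x‖ ≤ p.toSeminorm x) :
    UniformContinuous (fun x : p.Pre => f x) := by
  refine LipschitzWith.uniformContinuous (K := 1) (LipschitzWith.of_dist_le_mul fun x y => ?_)
  rw [dist_eq_norm, dist_eq_norm, NNReal.coe_one, one_mul]
  have h : f x - f y = f (show F from (x - y : p.Pre)) := (map_sub f (show F from x) y).symm
  rw [h]
  exact hf _

/-- The function underlying `extend`. -/
def extendFun (f : F →⋆ₙₐ[ℂ] C) : p.Completion → C :=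
  UniformSpace.Completion.extension (fun x : p.Pre => f x)

theorem continuous_extendFun (f : F →⋆ₙₐ[ℂ] C) : Continuous (p.extendFun f) :=
  UniformSpace.Completion.continuous_extension

variable {p} in
theorem extendFun_coe {f : F →⋆ₙₐ[ℂ] C} (hf : ∀ x, ‖f x‖ ≤ p.toSeminorm x) (x : F) :
    p.extendFun f (p.coe x) = f x :=
  UniformSpace.Completion.extension_coe (uniformContinuous_of_le hf) x

/-- A ⋆-homomorphism dominated by `p` extends to the completion. -/
def extend (f : F →⋆ₙₐ[ℂ] C) (hf : ∀ x, ‖f x‖ ≤ p.toSeminorm x) : p.Completion →⋆ₙₐ[ℂ] C where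
  toFun := p.extendFun f
  map_smul' c a := by
    have := p.continuous_extendFun f
    induction a using p.induction_on with
    | hc => exact isClosed_eq (this.comp (continuous_const_smul c)) (this.const_smul c)
    | h a => rw [← map_smul p.coe, extendFun_coe hf, extendFun_coe hf, map_smul]; rfl
  map_zero' := by rw [← _root_.map_zero p.coe, extendFun_coe hf, _root_.map_zero]
  map_add' a b := by
    have := p.continuous_extendFun f
    induction a, b using p.induction_on₂ with
    | hc => exact isClosed_eq (by fun_prop) (by fun_prop)
    | h a b => rw [← map_add, extendFun_coe hf, extendFun_coe hf, extendFun_coe hf, map_add]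
  map_mul' a b := by
    have := p.continuous_extendFun f
    induction a, b using p.induction_on₂ with
    | hc => exact isClosed_eq (by fun_prop) (by fun_prop)
    | h a b =>
      rw [← coe_mul, extendFun_coe hf, extendFun_coe hf, extendFun_coe hf, _root_.map_mul]
  map_star' a := by
    have := p.continuous_extendFun f
    induction a using p.induction_on with
    | hc => exact isClosed_eq (by fun_prop) (by fun_prop)
    | h a => rw [← coe_star, extendFun_coe hf, extendFun_coe hf, StarHomClass.map_star]

theorem extend_toCompletion (f : F →⋆ₙₐ[ℂ] C) (hf : ∀ x, ‖f x‖ ≤ p.toSeminorm x) (x : F) :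
    p.extend f hf (p.toCompletion x) = f x :=
  extendFun_coe hf x

end CompletionInstances

end CStarSeminorm

/-! ### The free ⋆-algebra on a set with involution -/

/-- The reversal of words, with the involution applied to each letter. -/
def wordStar {X : Type*} [Star X] : FreeSemigroup X →ₙ* (FreeSemigroup X)ᵐᵒᵖ :=
  FreeSemigroup.lift fun x => MulOpposite.op (FreeSemigroup.of (star x))

theorem wordStar_of {X : Type*} [Star X] (x : X) :
    (wordStar (FreeSemigroup.of x)).unop = FreeSemigroup.of (star x) := rfl

theorem wordStar_mul {X : Type*} [Star X] (v w : FreeSemigroup X) :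
    (wordStar (v * w)).unop = (wordStar w).unop * (wordStar v).unop := by
  simp [map_mul]

theorem wordStar_wordStar {X : Type*} [InvolutiveStar X] (w : FreeSemigroup X) :
    (wordStar (wordStar w).unop).unop = w := by
  induction w using FreeSemigroup.recOnMul with
  | ih1 x => simp [wordStar_of]
  | ih2 x w h1 h2 => rw [wordStar_mul, wordStar_mul, h1, h2]

/-- The free (non-unital) complex ⋆-algebra on a set `X` with an involution: finite formal
linear combinations of non-empty words in `X`. -/
def FreeStarAlgebra (X : Type*) : Type _ := MonoidAlgebra ℂ (FreeSemigroup X)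

namespace FreeStarAlgebra

section

variable {X : Type*}

instance : NonUnitalRing (FreeStarAlgebra X) :=
  inferInstanceAs (NonUnitalRing (MonoidAlgebra ℂ (FreeSemigroup X)))
instance : Module ℂ (FreeStarAlgebra X) :=
  inferInstanceAs (Module ℂ (MonoidAlgebra ℂ (FreeSemigroup X)))
instance : IsScalarTower ℂ (FreeStarAlgebra X) (FreeStarAlgebra X) :=
  inferInstanceAs (IsScalarTower ℂ (MonoidAlgebra ℂ (FreeSemigroup X)) (MonoidAlgebra ℂ (FreeSemigroup X)))
instance : SMulCommClass ℂ (FreeStarAlgebra X) (FreeStarAlgebra X) :=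
  inferInstanceAs (SMulCommClass ℂ (MonoidAlgebra ℂ (FreeSemigroup X)) (MonoidAlgebra ℂ (FreeSemigroup X)))

/-- The monomial `c • w`. -/
def mono (w : FreeSemigroup X) (c : ℂ) : FreeStarAlgebra X := MonoidAlgebra.single w c

/-- The generator of the free ⋆-algebra given by a letter. -/
def ι (x : X) : FreeStarAlgebra X := mono (FreeSemigroup.of x) 1

theorem mono_add (w : FreeSemigroup X) (c d : ℂ) : mono w (c + d) = mono w c + mono w d :=
  MonoidAlgebra.single_add w c d

theorem mono_mul (v w : FreeSemigroup X) (c d : ℂ) :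
    mono v c * mono w d = mono (v * w) (c * d) :=
  MonoidAlgebra.single_mul_single v w c d

theorem smul_mono (w : FreeSemigroup X) (c d : ℂ) : c • mono w d = mono w (c * d) :=
  MonoidAlgebra.smul_single c w d

theorem mono_of_mul (x : X) (w : FreeSemigroup X) :
    mono (FreeSemigroup.of x * w) 1 = ι x * mono w 1 := by
  rw [ι, mono_mul, one_mul]

theorem mono_eq_smul (w : FreeSemigroup X) (c : ℂ) : mono w c = c • mono w 1 := by
  rw [smul_mono, mul_one]

theorem addHom_ext {N : Type*} [AddZeroClass N] {f g : FreeStarAlgebra X →+ N}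
    (h : ∀ w c, f (mono w c) = g (mono w c)) : f = g :=
  MonoidAlgebra.addMonoidHom_ext h

theorem induction {P : FreeStarAlgebra X → Prop} (x : FreeStarAlgebra X) (h0 : P 0)
    (hm : ∀ w c, P (mono w c)) (ha : ∀ x y, P x → P y → P (x + y)) : P x := by
  have : ∀ f : FreeSemigroup X →₀ ℂ, P (MonoidAlgebra.ofCoeff f) := by
    intro f
    induction f using Finsupp.induction_linear with
    | zero => exact h0
    | add f g hf hg => exact ha _ _ hf hg
    | single w c => exact hm w c
  exact this x.coeff

/-- The extension of a map on letters to the free algebra. -/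
def liftAlg {C : Type*} [NonUnitalRing C] [Module ℂ C] [IsScalarTower ℂ C C]
    [SMulCommClass ℂ C C] (f : X → C) : FreeStarAlgebra X →ₙₐ[ℂ] C :=
  MonoidAlgebra.liftMagma ℂ (FreeSemigroup.lift f)

theorem liftAlg_mono {C : Type*} [NonUnitalRing C] [Module ℂ C] [IsScalarTower ℂ C C]
    [SMulCommClass ℂ C C] (f : X → C) (w : FreeSemigroup X) (c : ℂ) :
    liftAlg f (mono w c) = c • FreeSemigroup.lift f w := by
  have h : ∀ g : FreeSemigroup X →ₙ* C,
      MonoidAlgebra.liftMagma ℂ g (MonoidAlgebra.single w c) = c • g w := fun g => by simp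
  exact h _

end

variable {X : Type*} [InvolutiveStar X]

/-- The conjugate-linear extension of `wordStar`. -/
def starAddHom : FreeStarAlgebra X →+ FreeStarAlgebra X :=
  (Finsupp.liftAddHom fun w : FreeSemigroup X =>
    ((AddMonoidHom.mk' (mono (wordStar w).unop) (mono_add _)).comp
      (starAddEquiv : ℂ ≃+ ℂ).toAddMonoidHom)).comp
    (MonoidAlgebra.coeffAddEquiv (R := ℂ) (M := FreeSemigroup X)).toAddMonoidHom

theorem starAddHom_mono (w : FreeSemigroup X) (c : ℂ) :
    starAddHom (mono w c) = mono (wordStar w).unop (star c) := by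
  have h : ∀ g : FreeSemigroup X → ℂ →+ FreeStarAlgebra X,
      (Finsupp.liftAddHom g) (MonoidAlgebra.coeffAddEquiv (R := ℂ) (M := FreeSemigroup X)
        (MonoidAlgebra.single w c)) = g w c := fun g => by simp
  exact h _

instance : Star (FreeStarAlgebra X) := ⟨starAddHom⟩

theorem star_mono (w : FreeSemigroup X) (c : ℂ) :
    star (mono w c) = mono (wordStar w).unop (star c) := starAddHom_mono w c

instance : StarRing (FreeStarAlgebra X) where
  star_add x y := map_add starAddHom x y
  star_involutive x := by
    have : (starAddHom.comp starAddHom : FreeStarAlgebra X →+ _) = AddMonoidHom.id _ :=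
      addHom_ext fun w c => by
        simp [starAddHom_mono, wordStar_wordStar]
    exact DFunLike.congr_fun this x
  star_mul x y := by
    change starAddHom (x * y) = starAddHom y * starAddHom x
    induction x using induction with
    | h0 => simp
    | ha x x' hx hx' => rw [add_mul, map_add, map_add, mul_add, hx, hx']
    | hm v c =>
      induction y using induction with
      | h0 => simp
      | ha y y' hy hy' => rw [mul_add, map_add, map_add, add_mul, hy, hy']
      | hm w d =>
        rw [mono_mul, starAddHom_mono, starAddHom_mono, starAddHom_mono, mono_mul, wordStar_mul,
          star_mul]

instance : StarModule ℂ (FreeStarAlgebra X) where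
  star_smul c x := by
    change starAddHom (c • x) = star c • starAddHom x
    induction x using induction with
    | h0 => simp
    | ha x x' hx hx' => rw [smul_add, map_add, map_add, smul_add, hx, hx']
    | hm v d => rw [smul_mono, starAddHom_mono, starAddHom_mono, smul_mono, star_mul, mul_comm]

theorem star_ι (x : X) : star (ι x) = ι (star x) := by
  rw [ι, star_mono, wordStar_of, star_one]; rfl

/-- The extension of a ⋆-preserving map on letters to the free ⋆-algebra. -/
def lift {C : Type*} [NonUnitalRing C] [StarRing C] [Module ℂ C] [IsScalarTower ℂ C C]
    [SMulCommClass ℂ C C] [StarModule ℂ C] (f : X → C) (hf : ∀ x, f (star x) = star (f x)) :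
    FreeStarAlgebra X →⋆ₙₐ[ℂ] C where
  __ := liftAlg f
  map_star' x := by
    change liftAlg f (star x) = star (liftAlg f x)
    have hw : ∀ w : FreeSemigroup X,
        FreeSemigroup.lift f (wordStar w).unop = star (FreeSemigroup.lift f w) := by
      intro w
      induction w using FreeSemigroup.recOnMul with
      | ih1 x => simp [wordStar_of, hf]
      | ih2 x w h1 h2 => rw [wordStar_mul, map_mul, map_mul, h1, h2, star_mul]
    induction x using induction with
    | h0 => simp
    | ha x x' hx hx' => rw [star_add, map_add, map_add, star_add, hx, hx']
    | hm v d => rw [star_mono, liftAlg_mono, liftAlg_mono, hw, star_smul]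

theorem lift_ι {C : Type*} [NonUnitalRing C] [StarRing C] [Module ℂ C] [IsScalarTower ℂ C C]
    [SMulCommClass ℂ C C] [StarModule ℂ C] (f : X → C) (hf : ∀ x, f (star x) = star (f x)) (x : X) :
    lift f hf (ι x) = f x := by
  change liftAlg f (mono _ _) = _
  rw [liftAlg_mono, one_smul, FreeSemigroup.lift_of]

/-- Two ⋆-homomorphisms that agree on the letters are equal. -/
theorem hom_ext {C : Type*} [NonUnitalRing C] [StarRing C] [Module ℂ C]
    {f g : FreeStarAlgebra X →⋆ₙₐ[ℂ] C} (h : ∀ x, f (ι x) = g (ι x)) (x : FreeStarAlgebra X) :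
    f x = g x := by
  induction x using induction with
  | h0 => rw [_root_.map_zero, _root_.map_zero]
  | ha x x' hx hx' => rw [map_add, map_add, hx, hx']
  | hm v c =>
    rw [mono_eq_smul, map_smul, map_smul]
    congr 1
    induction v using FreeSemigroup.recOnMul with
    | ih1 x => exact h x
    | ih2 x w h1 h2 => rw [mono_of_mul, map_mul, map_mul, h, h2]

/-- A family of C⋆-seminorms that is bounded at each letter is bounded at each element. -/
theorem exists_bound (s : Set (CStarSeminorm (FreeStarAlgebra X)))
    (hs : ∀ x : X, ∃ M : ℝ, ∀ p ∈ s, p.toSeminorm (ι x) ≤ M) (x : FreeStarAlgebra X) :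
    ∃ M : ℝ, ∀ p ∈ s, p.toSeminorm x ≤ M := by
  induction x using induction with
  | h0 => exact ⟨0, fun p _ => by simp⟩
  | ha x y hx hy =>
    obtain ⟨M, hM⟩ := hx
    obtain ⟨N, hN⟩ := hy
    exact ⟨M + N, fun p hp => (map_add_le_add _ _ _).trans (add_le_add (hM p hp) (hN p hp))⟩
  | hm v c =>
    have hv : ∃ M : ℝ, ∀ p ∈ s, p.toSeminorm (mono v 1) ≤ M := by
      induction v using FreeSemigroup.recOnMul with
      | ih1 x => exact hs x
      | ih2 x w h1 h2 =>
        obtain ⟨M, hM⟩ := h1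
        obtain ⟨N, hN⟩ := h2
        refine ⟨M * N, fun p hp => ?_⟩
        rw [mono_of_mul]
        refine (p.mul_le _ _).trans ?_
        exact mul_le_mul (hM p hp) (hN p hp) (apply_nonneg _ _)
          ((apply_nonneg _ _).trans (hM p hp))
    obtain ⟨M, hM⟩ := hv
    refine ⟨‖c‖ * M, fun p hp => ?_⟩
    rw [mono_eq_smul, map_smul_eq_mul]
    exact mul_le_mul_of_nonneg_left (hM p hp) (norm_nonneg c)

end FreeStarAlgebra

/-! ### Full amalgamated free products -/

section FreeProduct

variable {A B : Type*} [NonUnitalCStarAlgebra A] [NonUnitalCStarAlgebra B]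

/-- The letterwise involution on the disjoint union of two ⋆-algebras. -/
instance sumInvolutiveStar : InvolutiveStar (A ⊕ B) where
  star := Sum.map star star
  star_involutive x := by cases x <;> simp

variable {D : Type*} [NonUnitalCStarAlgebra D] (φA : D →⋆ₙₐ[ℂ] A) (φB : D →⋆ₙₐ[ℂ] B)

open FreeStarAlgebra in
/-- The C⋆-seminorms on the free ⋆-algebra on `A ⊔ B` for which the inclusions of `A` and of `B`
become ⋆-homomorphisms that agree on `D`. -/
structure IsAmalgamSeminorm (p : CStarSeminorm (FreeStarAlgebra (A ⊕ B))) : Prop where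
  add_left : ∀ a a' : A,
    p.toSeminorm (ι (.inl (a + a')) - (ι (.inl a) + ι (.inl a'))) = 0
  smul_left : ∀ (c : ℂ) (a : A), p.toSeminorm (ι (.inl (c • a)) - c • ι (.inl a)) = 0
  mul_left : ∀ a a' : A, p.toSeminorm (ι (.inl (a * a')) - ι (.inl a) * ι (.inl a')) = 0
  add_right : ∀ b b' : B,
    p.toSeminorm (ι (.inr (b + b')) - (ι (.inr b) + ι (.inr b'))) = 0
  smul_right : ∀ (c : ℂ) (b : B), p.toSeminorm (ι (.inr (c • b)) - c • ι (.inr b)) = 0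
  mul_right : ∀ b b' : B, p.toSeminorm (ι (.inr (b * b')) - ι (.inr b) * ι (.inr b')) = 0
  amalgam : ∀ d : D, p.toSeminorm (ι (.inl (φA d)) - ι (.inr (φB d))) = 0

namespace IsAmalgamSeminorm

open FreeStarAlgebra CStarSeminorm

variable {φA φB} {p : CStarSeminorm (FreeStarAlgebra (A ⊕ B))}

theorem eq_of_sub {x y : FreeStarAlgebra (A ⊕ B)} (h : p.toSeminorm (x - y) = 0) :
    p.toCompletion x = p.toCompletion y := by
  rw [← sub_eq_zero, ← map_sub, ← norm_eq_zero, norm_toCompletion, h]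

/-- The ⋆-homomorphism from `A` into the completion. -/
def left (h : IsAmalgamSeminorm φA φB p) : A →⋆ₙₐ[ℂ] p.Completion where
  toFun a := p.toCompletion (ι (.inl a))
  map_smul' c a := by rw [eq_of_sub (h.smul_left c a), map_smul]; rfl
  map_zero' := by
    have := eq_of_sub (h.smul_left 0 0)
    rwa [zero_smul, zero_smul, map_zero] at this
  map_add' a a' := by rw [eq_of_sub (h.add_left a a'), map_add]
  map_mul' a a' := by rw [eq_of_sub (h.mul_left a a'), map_mul]
  map_star' a := by rw [← StarHomClass.map_star, star_ι]; rfl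

/-- The ⋆-homomorphism from `B` into the completion. -/
def right (h : IsAmalgamSeminorm φA φB p) : B →⋆ₙₐ[ℂ] p.Completion where
  toFun b := p.toCompletion (ι (.inr b))
  map_smul' c b := by rw [eq_of_sub (h.smul_right c b), map_smul]; rfl
  map_zero' := by
    have := eq_of_sub (h.smul_right 0 0)
    rwa [zero_smul, zero_smul, map_zero] at this
  map_add' b b' := by rw [eq_of_sub (h.add_right b b'), map_add]
  map_mul' b b' := by rw [eq_of_sub (h.mul_right b b'), map_mul]
  map_star' b := by rw [← StarHomClass.map_star, star_ι]; rfl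

theorem le_norm (h : IsAmalgamSeminorm φA φB p) (x : A ⊕ B) :
    p.toSeminorm (ι x) ≤ x.elim norm norm := by
  rw [← norm_toCompletion]
  cases x with
  | inl a => exact NonUnitalStarAlgHom.norm_apply_le h.left a
  | inr b => exact NonUnitalStarAlgHom.norm_apply_le h.right b

end IsAmalgamSeminorm

theorem exists_amalgam_bound (x : FreeStarAlgebra (A ⊕ B)) :
    ∃ M : ℝ, ∀ p ∈ {p | IsAmalgamSeminorm φA φB p}, p.toSeminorm x ≤ M :=
  FreeStarAlgebra.exists_bound _ (fun x => ⟨x.elim norm norm, fun _ hp => hp.le_norm x⟩) x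

theorem bddAbove_amalgam (x : FreeStarAlgebra (A ⊕ B)) :
    BddAbove (Set.range fun p : {p // IsAmalgamSeminorm φA φB p} => p.1.toSeminorm x) := by
  obtain ⟨M, hM⟩ := exists_amalgam_bound φA φB x
  exact ⟨M, by rintro _ ⟨p, rfl⟩; exact hM p.1 p.2⟩

instance nonempty_amalgam : Nonempty {p // IsAmalgamSeminorm φA φB p} :=
  ⟨⟨⟨0, fun _ _ => (mul_zero (0 : ℝ)).ge, fun _ => (mul_zero (0 : ℝ)).symm⟩, by constructor <;> intros <;> rfl⟩⟩

/-- The largest C⋆-seminorm on the free ⋆-algebra on `A ⊔ B` for which the inclusions of `A` and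
of `B` become ⋆-homomorphisms that agree on `D`. -/
def maxSeminorm : CStarSeminorm (FreeStarAlgebra (A ⊕ B)) where
  toFun x := ⨆ p : {p // IsAmalgamSeminorm φA φB p}, p.1.toSeminorm x
  map_zero' := by simp
  add_le' x y := ciSup_le fun p => (map_add_le_add _ _ _).trans
    (add_le_add (le_ciSup (bddAbove_amalgam φA φB x) p) (le_ciSup (bddAbove_amalgam φA φB y) p))
  neg' x := by simp
  smul' c x := by
    simp only [map_smul_eq_mul]
    exact (Real.mul_iSup_of_nonneg (norm_nonneg c) _).symm
  mul_le' x y := ciSup_le fun p => (p.1.mul_le _ _).trans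
    (mul_le_mul (le_ciSup (bddAbove_amalgam φA φB x) p) (le_ciSup (bddAbove_amalgam φA φB y) p)
      (apply_nonneg _ _) (Real.iSup_nonneg fun p => apply_nonneg _ _))
  star_mul_self' x := by
    simp only [CStarSeminorm.star_mul_self]
    have hb : BddAbove (Set.range fun p : {p // IsAmalgamSeminorm φA φB p} =>
        p.1.toSeminorm x * p.1.toSeminorm x) := by
      simpa only [CStarSeminorm.star_mul_self] using bddAbove_amalgam φA φB (star x * x)
    refine le_antisymm (ciSup_le fun p => ?_) ?_
    · exact mul_self_le_mul_self (apply_nonneg _ _) (le_ciSup (bddAbove_amalgam φA φB x) p)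
    · have h1 : (⨆ p : {p // IsAmalgamSeminorm φA φB p}, p.1.toSeminorm x) ≤
          √(⨆ p : {p // IsAmalgamSeminorm φA φB p}, p.1.toSeminorm x * p.1.toSeminorm x) :=
        ciSup_le fun p => Real.le_sqrt_of_sq_le (by rw [sq]; exact le_ciSup hb p)
      refine (mul_self_le_mul_self (Real.iSup_nonneg fun p => apply_nonneg _ _) h1).trans_eq ?_
      exact Real.mul_self_sqrt (Real.iSup_nonneg fun p => mul_self_nonneg _)

theorem le_maxSeminorm {p : CStarSeminorm (FreeStarAlgebra (A ⊕ B))}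
    (h : IsAmalgamSeminorm φA φB p) (x : FreeStarAlgebra (A ⊕ B)) :
    p.toSeminorm x ≤ (maxSeminorm φA φB).toSeminorm x :=
  le_ciSup (bddAbove_amalgam φA φB x) ⟨p, h⟩

theorem maxSeminorm_eq_zero {x : FreeStarAlgebra (A ⊕ B)}
    (h : ∀ p, IsAmalgamSeminorm φA φB p → p.toSeminorm x = 0) :
    (maxSeminorm φA φB).toSeminorm x = 0 := by
  change (⨆ p : {p // IsAmalgamSeminorm φA φB p}, p.1.toSeminorm x) = 0
  simp [fun p : {p // IsAmalgamSeminorm φA φB p} => h p.1 p.2]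

theorem isAmalgamSeminorm_maxSeminorm : IsAmalgamSeminorm φA φB (maxSeminorm φA φB) where
  add_left a a' := maxSeminorm_eq_zero φA φB fun _ h => h.add_left a a'
  smul_left c a := maxSeminorm_eq_zero φA φB fun _ h => h.smul_left c a
  mul_left a a' := maxSeminorm_eq_zero φA φB fun _ h => h.mul_left a a'
  add_right b b' := maxSeminorm_eq_zero φA φB fun _ h => h.add_right b b'
  smul_right c b := maxSeminorm_eq_zero φA φB fun _ h => h.smul_right c b
  mul_right b b' := maxSeminorm_eq_zero φA φB fun _ h => h.mul_right b b'
  amalgam d := maxSeminorm_eq_zero φA φB fun _ h => h.amalgam d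

/-- The full amalgamated free product C⋆-algebra `A *_D B` along `φA : D → A` and `φB : D → B`. -/
def FullFreeProduct : Type _ := (maxSeminorm φA φB).Completion

namespace FullFreeProduct

open FreeStarAlgebra CStarSeminorm

instance : NonUnitalCStarAlgebra (FullFreeProduct φA φB) :=
  inferInstanceAs (NonUnitalCStarAlgebra (maxSeminorm φA φB).Completion)

/-- The canonical ⋆-homomorphism from the free ⋆-algebra on `A ⊔ B`. -/
def mk : FreeStarAlgebra (A ⊕ B) →⋆ₙₐ[ℂ] FullFreeProduct φA φB := (maxSeminorm φA φB).toCompletion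

theorem denseRange_mk : DenseRange (mk φA φB) := (maxSeminorm φA φB).denseRange_toCompletion

/-- The canonical ⋆-homomorphism `A → A *_D B`. -/
def inl : A →⋆ₙₐ[ℂ] FullFreeProduct φA φB := (isAmalgamSeminorm_maxSeminorm φA φB).left

/-- The canonical ⋆-homomorphism `B → A *_D B`. -/
def inr : B →⋆ₙₐ[ℂ] FullFreeProduct φA φB := (isAmalgamSeminorm_maxSeminorm φA φB).right

theorem inl_comp_eq_inr_comp : (inl φA φB).comp φA = (inr φA φB).comp φB := by
  ext d
  exact IsAmalgamSeminorm.eq_of_sub ((isAmalgamSeminorm_maxSeminorm φA φB).amalgam d)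

section lift

variable {φA φB} {C : Type*} [NonUnitalCStarAlgebra C]

/-- The ⋆-homomorphism on the free ⋆-algebra on `A ⊔ B` given by maps on `A` and on `B`. -/
def preLift (f : A →⋆ₙₐ[ℂ] C) (g : B →⋆ₙₐ[ℂ] C) : FreeStarAlgebra (A ⊕ B) →⋆ₙₐ[ℂ] C :=
  FreeStarAlgebra.lift (Sum.elim f g) (by
    rintro (a | b)
    · exact StarHomClass.map_star f a
    · exact StarHomClass.map_star g b)

theorem preLift_inl (f : A →⋆ₙₐ[ℂ] C) (g : B →⋆ₙₐ[ℂ] C) (a : A) :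
    preLift f g (ι (.inl a)) = f a := lift_ι _ _ _

theorem preLift_inr (f : A →⋆ₙₐ[ℂ] C) (g : B →⋆ₙₐ[ℂ] C) (b : B) :
    preLift f g (ι (.inr b)) = g b := lift_ι _ _ _

theorem preLift_le (f : A →⋆ₙₐ[ℂ] C) (g : B →⋆ₙₐ[ℂ] C) (h : f.comp φA = g.comp φB)
    (x : FreeStarAlgebra (A ⊕ B)) : ‖preLift f g x‖ ≤ (maxSeminorm φA φB).toSeminorm x := by
  refine le_maxSeminorm φA φB (p := ofHom (preLift f g)) ?_ x
  have hd (d : D) : f (φA d) = g (φB d) := DFunLike.congr_fun h d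
  constructor <;> intros <;>
    simp [ofHom_apply, map_sub, preLift_inl, preLift_inr, hd]

/-- The universal property of `A *_D B`: ⋆-homomorphisms on `A` and on `B` that agree on `D`
extend to `A *_D B`. -/
def lift (f : A →⋆ₙₐ[ℂ] C) (g : B →⋆ₙₐ[ℂ] C) (h : f.comp φA = g.comp φB) :
    FullFreeProduct φA φB →⋆ₙₐ[ℂ] C :=
  (maxSeminorm φA φB).extend (preLift f g) (preLift_le f g h)

theorem lift_inl (f : A →⋆ₙₐ[ℂ] C) (g : B →⋆ₙₐ[ℂ] C) (h : f.comp φA = g.comp φB) (a : A) :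
    lift f g h (inl φA φB a) = f a :=
  (extend_toCompletion _ _ _ _).trans (preLift_inl f g a)

theorem lift_inr (f : A →⋆ₙₐ[ℂ] C) (g : B →⋆ₙₐ[ℂ] C) (h : f.comp φA = g.comp φB) (b : B) :
    lift f g h (inr φA φB b) = g b :=
  (extend_toCompletion _ _ _ _).trans (preLift_inr f g b)

/-- ⋆-homomorphisms on `A *_D B` are determined by their restrictions to `A` and to `B`. -/
theorem hom_ext {f g : FullFreeProduct φA φB →⋆ₙₐ[ℂ] C}
    (hl : f.comp (inl φA φB) = g.comp (inl φA φB))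
    (hr : f.comp (inr φA φB) = g.comp (inr φA φB)) : f = g := by
  have key : ∀ x, f (mk φA φB x) =
      g (mk φA φB x) := by
    refine FreeStarAlgebra.hom_ext (f := f.comp (mk φA φB))
      (g := g.comp (mk φA φB)) ?_
    rintro (a | b)
    · exact DFunLike.congr_fun hl a
    · exact DFunLike.congr_fun hr b
  refine DFunLike.coe_injective
    ((denseRange_mk φA φB).equalizer ?_ ?_ (funext key))
  · exact AddMonoidHomClass.continuous_of_bound f 1
      (by simpa only [one_mul] using NonUnitalStarAlgHom.norm_apply_le f)
  · exact AddMonoidHomClass.continuous_of_bound g 1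
      (by simpa only [one_mul] using NonUnitalStarAlgHom.norm_apply_le g)

end lift

/-- `A *_D B` is generated, as a C⋆-algebra, by the images of `A` and `B`. -/
theorem topologicalClosure_adjoin :
    (NonUnitalStarAlgebra.adjoin ℂ
      (Set.range (inl φA φB) ∪ Set.range (inr φA φB))).topologicalClosure = ⊤ := by
  set S := NonUnitalStarAlgebra.adjoin ℂ (Set.range (inl φA φB) ∪ Set.range (inr φA φB)) with hS
  have key : ∀ x, mk φA φB x ∈ S := by
    intro x
    have hgen : ∀ y : A ⊕ B, mk φA φB (ι y) ∈ S := by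
      rintro (a | b)
      · exact NonUnitalStarAlgebra.subset_adjoin ℂ _ (Or.inl ⟨a, rfl⟩)
      · exact NonUnitalStarAlgebra.subset_adjoin ℂ _ (Or.inr ⟨b, rfl⟩)
    induction x using FreeStarAlgebra.induction with
    | h0 => rw [_root_.map_zero]; exact zero_mem S
    | ha x y hx hy => rw [map_add]; exact add_mem hx hy
    | hm v c =>
      rw [mono_eq_smul, map_smul]
      refine SMulMemClass.smul_mem (S := NonUnitalStarSubalgebra ℂ (FullFreeProduct φA φB)) c ?_
      induction v using FreeSemigroup.recOnMul with
      | ih1 x => exact hgen x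
      | ih2 x w h1 h2 => rw [mono_of_mul, map_mul]; exact mul_mem (hgen x) h2
  refine eq_top_iff.2 fun x _ => ?_
  refine closure_mono ?_ ((denseRange_mk φA φB) x)
  rintro _ ⟨y, rfl⟩
  exact key y

end FullFreeProduct

end FreeProduct

namespace FullFreeProduct

variable {A B D A' B' D' : Type*} [NonUnitalCStarAlgebra A] [NonUnitalCStarAlgebra B]
  [NonUnitalCStarAlgebra D] [NonUnitalCStarAlgebra A'] [NonUnitalCStarAlgebra B']
  [NonUnitalCStarAlgebra D'] {φA : D →⋆ₙₐ[ℂ] A} {φB : D →⋆ₙₐ[ℂ] B}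
  {φA' : D' →⋆ₙₐ[ℂ] A'} {φB' : D' →⋆ₙₐ[ℂ] B'}

/-- The ⋆-homomorphism `A *_D B → A' *_{D'} B'` that arises, through the universal property, from
⋆-homomorphisms `A → A'`, `B → B'` and `D → D'` that make the squares commute. -/
def map (lA : A →⋆ₙₐ[ℂ] A') (lB : B →⋆ₙₐ[ℂ] B') (lD : D →⋆ₙₐ[ℂ] D')
    (hA : lA.comp φA = φA'.comp lD) (hB : lB.comp φB = φB'.comp lD) :
    FullFreeProduct φA φB →⋆ₙₐ[ℂ] FullFreeProduct φA' φB' :=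
  lift ((inl φA' φB').comp lA) ((inr φA' φB').comp lB) (by
    rw [NonUnitalStarAlgHom.comp_assoc, hA, ← NonUnitalStarAlgHom.comp_assoc,
      inl_comp_eq_inr_comp, NonUnitalStarAlgHom.comp_assoc, ← hB,
      ← NonUnitalStarAlgHom.comp_assoc])

theorem map_inl (lA : A →⋆ₙₐ[ℂ] A') (lB : B →⋆ₙₐ[ℂ] B') (lD : D →⋆ₙₐ[ℂ] D')
    (hA : lA.comp φA = φA'.comp lD) (hB : lB.comp φB = φB'.comp lD) (a : A) :
    map lA lB lD hA hB (inl φA φB a) = inl φA' φB' (lA a) := lift_inl _ _ _ a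

theorem map_inr (lA : A →⋆ₙₐ[ℂ] A') (lB : B →⋆ₙₐ[ℂ] B') (lD : D →⋆ₙₐ[ℂ] D')
    (hA : lA.comp φA = φA'.comp lD) (hB : lB.comp φB = φB'.comp lD) (b : B) :
    map lA lB lD hA hB (inr φA φB b) = inr φA' φB' (lB b) := lift_inr _ _ _ b

end FullFreeProduct

/-! ### Sums of C⋆-subalgebras and ideals -/

section IdealSum

variable {E : Type*} [CStarAlgebra E] (I : Submodule ℂ E)

theorem cfc_sub_cfc_mem (hI : IsClosed (I : Set E)) (hl : ∀ a, ∀ k ∈ I, a * k ∈ I)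
    (hr : ∀ a, ∀ k ∈ I, k * a ∈ I) {c d : E} (hc : IsSelfAdjoint c) (hd : IsSelfAdjoint d)
    (hcd : c - d ∈ I) (f : ℝ → ℝ) (hf : Continuous f) : cfc f c - cfc f d ∈ I := by
  let s : Set ℝ := spectrum ℝ c ∪ spectrum ℝ d
  have hsc : spectrum ℝ c ⊆ s := Set.subset_union_left
  have hsd : spectrum ℝ d ⊆ s := Set.subset_union_right
  have hs : CompactSpace s := isCompact_iff_compactSpace.1
    ((ContinuousFunctionalCalculus.isCompact_spectrum c).union
      (ContinuousFunctionalCalculus.isCompact_spectrum d))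
  have key : ∀ g : C(s, ℝ), cfcHomSuperset hc hsc g - cfcHomSuperset hd hsd g ∈ I := by
    intro g
    induction g using ContinuousMap.induction_on_of_compact with
    | const r =>
      have h : (ContinuousMap.const s r) = algebraMap ℝ C(s, ℝ) r := rfl
      rw [h, AlgHomClass.commutes, AlgHomClass.commutes, sub_self]
      exact zero_mem I
    | id => rwa [cfcHomSuperset_id, cfcHomSuperset_id]
    | star_id =>
      have h : star (ContinuousMap.restrict s (.id ℝ)) = ContinuousMap.restrict s (.id ℝ) := by
        ext; simp
      rwa [h, cfcHomSuperset_id, cfcHomSuperset_id]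
    | add f g hf hg =>
      rw [map_add, map_add, add_sub_add_comm]
      exact add_mem hf hg
    | mul f g hf hg =>
      have e : ∀ a b a' b' : E, a * b - a' * b' = a * (b - b') + (a - a') * b' := by
        intros; noncomm_ring
      rw [map_mul, map_mul, e]
      exact add_mem (hl _ _ hg) (hr _ _ hf)
    | frequently f h =>
      refine h.mem_of_closed (hI.preimage ?_)
      exact (cfcHomSuperset_continuous hc hsc).sub (cfcHomSuperset_continuous hd hsd)
  have h := key ⟨fun x => f x, hf.comp continuous_subtype_val⟩
  rw [cfc_apply f c, cfc_apply f d]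
  exact h

/-- An auxiliary function. -/
def cutoff (r t : ℝ) : ℝ := r / max r (√t)

theorem continuous_cutoff {r : ℝ} (hr : 0 < r) : Continuous (cutoff r) :=
  continuous_const.div (continuous_const.max Real.continuous_sqrt)
    fun _ => (lt_max_of_lt_left hr).ne'

theorem cutoff_eq_one {r t : ℝ} (hr : 0 < r) (ht : t ≤ r ^ 2) : cutoff r t = 1 := by
  have : √t ≤ r := (Real.sqrt_le_left hr.le).2 ht
  rw [cutoff, max_eq_left this, div_self hr.ne']

theorem cutoff_sq_mul_le {r t : ℝ} (hr : 0 < r) (ht : 0 ≤ t) :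
    ‖cutoff r t * t * cutoff r t‖ ≤ r ^ 2 := by
  have hm : 0 < max r (√t) := lt_max_of_lt_left hr
  have h1 : cutoff r t * √t ≤ r := by
    rw [cutoff, div_mul_eq_mul_div, div_le_iff₀ hm]
    exact mul_le_mul_of_nonneg_left (le_max_right _ _) hr.le
  have h0 : 0 ≤ cutoff r t * √t := mul_nonneg (div_nonneg hr.le hm.le) (Real.sqrt_nonneg t)
  have h2 : cutoff r t * t * cutoff r t = (cutoff r t * √t) ^ 2 := by
    rw [mul_pow, Real.sq_sqrt ht]; ring
  rw [h2, Real.norm_of_nonneg (sq_nonneg _)]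
  exact pow_le_pow_left₀ h0 h1 2

theorem norm_mul_cfc_cutoff_le {r : ℝ} (hr : 0 < r) (b : E) :
    ‖b * cfc (cutoff r) (star b * b)‖ ≤ r := by
  have hcont := continuous_cutoff hr
  set c := star b * b with hc
  have hsa : IsSelfAdjoint c := IsSelfAdjoint.star_mul_self b
  have h1 : star (b * cfc (cutoff r) c) * (b * cfc (cutoff r) c) =
      cfc (fun t => cutoff r t * t * cutoff r t) c := by
    have hs : star (cfc (cutoff r) c) = cfc (cutoff r) c := (cfc_predicate (cutoff r) c : _)
    rw [cfc_mul (fun t => cutoff r t * t) (cutoff r) c, cfc_mul (cutoff r) (fun t => t) c,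
      cfc_id' ℝ c, star_mul, hs, hc]
    simp only [mul_assoc]
  have h2 : ‖b * cfc (cutoff r) c‖ * ‖b * cfc (cutoff r) c‖ ≤ r ^ 2 := by
    rw [← CStarRing.norm_star_mul_self, h1]
    refine norm_cfc_le (by positivity) fun t ht => cutoff_sq_mul_le hr ?_
    exact spectrum_star_mul_self_nonneg t ht
  exact abs_le_of_sq_le_sq' (by nlinarith) hr.le |>.2

/-- Closed two-sided ideals in C⋆-algebras are self-adjoint. -/
theorem star_mem_of_closed_ideal (hI : IsClosed (I : Set E)) (hl : ∀ a, ∀ k ∈ I, a * k ∈ I)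
    (hr : ∀ a, ∀ k ∈ I, k * a ∈ I) {k : E} (hk : k ∈ I) : star k ∈ I := by
  have : star k ∈ closure (I : Set E) := by
    refine Metric.mem_closure_iff.2 fun ε hε => ?_
    have hε2 : 0 < ε / 2 := by positivity
    have hcont := continuous_cutoff hε2
    have h1 := cfc_sub_cfc_mem I hI hl hr (IsSelfAdjoint.star_mul_self k) (.zero E)
      (by rw [sub_zero]; exact hl _ _ hk) (cutoff (ε / 2)) hcont
    have h0 : cfc (cutoff (ε / 2)) (0 : E) = 1 := by
      rw [cfc_apply_zero, cutoff_eq_one hε2 (by positivity), map_one]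
    rw [h0] at h1
    have hs : star (cfc (cutoff (ε / 2)) (star k * k)) = cfc (cutoff (ε / 2)) (star k * k) :=
      (cfc_predicate (cutoff (ε / 2)) (star k * k) : _)
    refine ⟨(1 - cfc (cutoff (ε / 2)) (star k * k)) * star k, hr _ _ ?_, ?_⟩
    · rw [← neg_sub]; exact neg_mem h1
    · rw [dist_eq_norm, sub_mul, one_mul, sub_sub_cancel]
      have h2 : cfc (cutoff (ε / 2)) (star k * k) * star k =
          star (k * cfc (cutoff (ε / 2)) (star k * k)) := by rw [star_mul, hs]
      rw [h2, norm_star]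
      exact (norm_mul_cfc_cutoff_le hε2 k).trans_lt (by linarith)
  rwa [hI.closure_eq] at this

/-- The sum of a C⋆-subalgebra and a closed two-sided ideal is closed. -/
theorem isClosed_add_ideal (hI : IsClosed (I : Set E)) (hl : ∀ a, ∀ k ∈ I, a * k ∈ I)
    (hr : ∀ a, ∀ k ∈ I, k * a ∈ I) (S : StarSubalgebra ℂ E) (hS : IsClosed (S : Set E)) :
    IsClosed {x : E | ∃ s ∈ S, ∃ k ∈ I, x = s + k} := by
  let S' : Submodule ℂ E := Subalgebra.toSubmodule S.toSubalgebra
  have : CompleteSpace S' := IsClosed.completeSpace_coe (hs := hS)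
  have : CompleteSpace I := hI.completeSpace_coe
  let f : NormedAddGroupHom (S' × I) E :=
    (S'.subtype.toAddMonoidHom.coprod I.subtype.toAddMonoidHom).mkNormedAddGroupHom 2 (by
      rintro ⟨s, k⟩
      have h1 : ‖(s : E)‖ ≤ ‖(s, k)‖ := le_max_left _ _
      have h2 : ‖(k : E)‖ ≤ ‖(s, k)‖ := le_max_right _ _
      have h3 := norm_add_le (s : E) (k : E)
      change ‖(s : E) + (k : E)‖ ≤ _
      linarith)
  have hf : ∀ (s : S') (k : I), f (s, k) = (s : E) + (k : E) := fun _ _ => rfl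
  have hsurj : f.SurjectiveOnWith f.range 3 := by
    rintro _ ⟨⟨b, k₀⟩, rfl⟩
    set x : E := f (b, k₀) with hx
    rw [hf] at hx
    rcases eq_or_ne x 0 with h0 | h0
    · exact ⟨0, by rw [map_zero]; exact h0.symm, by simp⟩
    set r := ‖x‖ with hr'
    have hrpos : 0 < r := norm_pos_iff.2 h0
    have hbx : star (b : E) * b - star x * x ∈ I := by
      have hk : (k₀ : E) ∈ I := k₀.2
      have e : star (b : E) * b - star x * x =
          -(star (b : E) * k₀ + star (k₀ : E) * b + star (k₀ : E) * k₀) := by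
        rw [hx, star_add]; noncomm_ring
      rw [e]
      have hsk := star_mem_of_closed_ideal I hI hl hr hk
      exact neg_mem (add_mem (add_mem (hl _ _ hk) (hr _ _ hsk)) (hl _ _ hk))
    have h1 := cfc_sub_cfc_mem I hI hl hr (IsSelfAdjoint.star_mul_self (b : E))
      (IsSelfAdjoint.star_mul_self x) hbx (cutoff r) (continuous_cutoff hrpos)
    have h2 : cfc (cutoff r) (star x * x) = 1 := by
      have : Nontrivial E := ⟨x, 0, h0⟩
      have hsa : IsSelfAdjoint (star x * x) := .star_mul_self x
      rw [← cfc_one ℝ (star x * x)]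
      refine cfc_congr fun t ht => cutoff_eq_one hrpos ?_
      have := spectrum.norm_le_norm_of_mem ht
      rw [CStarRing.norm_star_mul_self, ← sq] at this
      exact (Real.le_norm_self t).trans this
    rw [h2] at h1
    have hbS : (b : E) ∈ S := b.2
    have h3 : (b : E) * cfc (cutoff r) (star (b : E) * b) ∈ S := by
      refine mul_mem hbS ?_
      exact cfc_mem (𝕜' := ℂ) (hs := hS) _ (mul_mem (star_mem hbS) hbS)
    set y : E := (b : E) * cfc (cutoff r) (star (b : E) * b) with hy
    have h4 : ‖y‖ ≤ r := norm_mul_cfc_cutoff_le hrpos _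
    have h5 : x - y ∈ I := by
      have : x - y = k₀ - (b : E) * (cfc (cutoff r) (star (b : E) * b) - 1) := by
        rw [hx, hy]; noncomm_ring
      rw [this]
      exact sub_mem k₀.2 (hl _ _ h1)
    refine ⟨(⟨y, h3⟩, ⟨x - y, h5⟩), by rw [hf]; exact add_sub_cancel y x, ?_⟩
    refine max_le ?_ ?_
    · change ‖y‖ ≤ 3 * r
      linarith
    · change ‖x - y‖ ≤ 3 * r
      have := norm_sub_le x y
      linarith
  have hclosed := controlled_closure_of_complete (by norm_num : (0 : ℝ) < 3) one_pos hsurj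
  have hset : {x : E | ∃ s ∈ S, ∃ k ∈ I, x = s + k} = (f.range : Set E) := by
    ext x
    constructor
    · rintro ⟨s, hs, k, hk, rfl⟩
      exact ⟨(⟨s, hs⟩, ⟨k, hk⟩), rfl⟩
    · rintro ⟨⟨s, k⟩, rfl⟩
      exact ⟨s, s.2, k, k.2, rfl⟩
  rw [hset]
  refine isClosed_of_closure_subset fun x hx => ?_
  obtain ⟨g, hg, -⟩ := hclosed x hx
  exact ⟨g, hg⟩

end IdealSum

/-! ### Algebras of the form `S + K(H)` -/

section Compacts

set_option linter.unusedSectionVars false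

variable {H : Type*} [NormedAddCommGroup H] [InnerProductSpace ℂ H] [CompleteSpace H]

theorem compact_mul_left (a k : H →L[ℂ] H) (hk : IsCompactOperator k) :
    IsCompactOperator (a * k : H →L[ℂ] H) := hk.clm_comp a

theorem compact_mul_right (a k : H →L[ℂ] H) (hk : IsCompactOperator k) :
    IsCompactOperator (k * a : H →L[ℂ] H) := hk.comp_clm a

theorem isClosed_compactOperator :
    IsClosed (compactOperator (RingHom.id ℂ) H H : Set (H →L[ℂ] H)) :=
  isClosed_setOfPred_isCompactOperator

theorem compact_star (k : H →L[ℂ] H) (hk : IsCompactOperator k) :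
    IsCompactOperator (star k : H →L[ℂ] H) :=
  star_mem_of_closed_ideal (compactOperator (RingHom.id ℂ) H H) isClosed_compactOperator
    compact_mul_left (fun a k hk => compact_mul_right a k hk) hk

/-- The ⋆-subalgebra `S + K(H)` of `B(H)`. -/
def addCompacts (S : StarSubalgebra ℂ (H →L[ℂ] H)) : StarSubalgebra ℂ (H →L[ℂ] H) where
  carrier := {x | ∃ s ∈ S, ∃ k : H →L[ℂ] H, IsCompactOperator k ∧ x = s + k}
  mul_mem' := by
    rintro _ _ ⟨s, hs, k, hk, rfl⟩ ⟨t, ht, l, hl, rfl⟩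
    refine ⟨s * t, mul_mem hs ht, s * l + k * t + k * l, ?_, by noncomm_ring⟩
    exact ((compact_mul_left s l hl).add (compact_mul_right t k hk)).add (compact_mul_left k l hl)
  add_mem' := by
    rintro _ _ ⟨s, hs, k, hk, rfl⟩ ⟨t, ht, l, hl, rfl⟩
    exact ⟨s + t, add_mem hs ht, k + l, hk.add hl, add_add_add_comm _ _ _ _⟩
  algebraMap_mem' c := ⟨_, algebraMap_mem S c, 0, isCompactOperator_zero, (add_zero _).symm⟩
  star_mem' := by
    rintro _ ⟨s, hs, k, hk, rfl⟩
    exact ⟨star s, star_mem hs, star k, compact_star k hk, star_add s k⟩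

theorem mem_addCompacts {S : StarSubalgebra ℂ (H →L[ℂ] H)} {x : H →L[ℂ] H} :
    x ∈ addCompacts S ↔ ∃ s ∈ S, ∃ k : H →L[ℂ] H, IsCompactOperator k ∧ x = s + k := Iff.rfl

theorem le_addCompacts (S : StarSubalgebra ℂ (H →L[ℂ] H)) : S ≤ addCompacts S :=
  fun s hs => ⟨s, hs, 0, isCompactOperator_zero, (add_zero s).symm⟩

theorem addCompacts_mono {S T : StarSubalgebra ℂ (H →L[ℂ] H)} (h : S ≤ T) :
    addCompacts S ≤ addCompacts T := by
  rintro _ ⟨s, hs, k, hk, rfl⟩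
  exact ⟨s, h hs, k, hk, rfl⟩

instance isClosed_addCompacts (S : StarSubalgebra ℂ (H →L[ℂ] H))
    [hS : IsClosed (S : Set (H →L[ℂ] H))] : IsClosed (addCompacts S : Set (H →L[ℂ] H)) :=
  isClosed_add_ideal (compactOperator (RingHom.id ℂ) H H) isClosed_compactOperator
    compact_mul_left (fun a k hk => compact_mul_right a k hk) S hS

instance isClosed_scalars : IsClosed ((⊥ : StarSubalgebra ℂ (H →L[ℂ] H)) : Set (H →L[ℂ] H)) := by
  have h : ((⊥ : StarSubalgebra ℂ (H →L[ℂ] H)) : Set (H →L[ℂ] H)) =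
      (Submodule.span ℂ {(1 : H →L[ℂ] H)} : Set (H →L[ℂ] H)) := by
    ext x
    simp [Submodule.mem_span_singleton, Algebra.algebraMap_eq_smul_one]
  rw [h]
  exact Submodule.closed_of_finiteDimensional _

instance isClosed_elemental (u : H →L[ℂ] H) :
    IsClosed (StarAlgebra.elemental ℂ u : Set (H →L[ℂ] H)) :=
  StarAlgebra.elemental.isClosed ℂ u

/-- The ⋆-homomorphisms between two C⋆-algebras. (With this abbreviation the algebra structures on
C⋆-subalgebras are found through their C⋆-algebra structure.) -/
abbrev CStarHom (A B : Type*) [NonUnitalCStarAlgebra A] [NonUnitalCStarAlgebra B] : Type _ :=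
  A →⋆ₙₐ[ℂ] B

/-- The inclusion of a C⋆-subalgebra of `B(H)` in a larger one. -/
def incl {S T : StarSubalgebra ℂ (H →L[ℂ] H)} [IsClosed (S : Set (H →L[ℂ] H))]
    [IsClosed (T : Set (H →L[ℂ] H))] (h : S ≤ T) : CStarHom S T :=
  (StarSubalgebra.inclusion h).toNonUnitalStarAlgHom

/-- The full free product `(S + K(H)) *_S (S + K(H))` for a C⋆-subalgebra `S` of `B(H)`. -/
abbrev CompactsFreeProduct (S : StarSubalgebra ℂ (H →L[ℂ] H))
    [IsClosed (S : Set (H →L[ℂ] H))] : Type _ :=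
  FullFreeProduct (incl (le_addCompacts S)) (incl (le_addCompacts S))

/-- The ⋆-homomorphism `(S + K(H)) *_S (S + K(H)) → (T + K(H)) *_T (T + K(H))` that arises from
the inclusions, for C⋆-subalgebras `S ⊆ T` of `B(H)`. -/
def compactsFreeProductMap {S T : StarSubalgebra ℂ (H →L[ℂ] H)}
    [IsClosed (S : Set (H →L[ℂ] H))] [IsClosed (T : Set (H →L[ℂ] H))] (h : S ≤ T) :
    CompactsFreeProduct S →⋆ₙₐ[ℂ] CompactsFreeProduct T :=
  FullFreeProduct.map (incl (addCompacts_mono h)) (incl (addCompacts_mono h)) (incl h) rfl rfl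

end Compacts

end

/-! In a free product amalgamated over an algebra that contains `u`, the operator `u` may be moved
from one factor to the other: for compact `k` and `l`, the product of `k * u` in the left factor
with `l` in the right one equals the product of `k` on the left with `u * l` on the right. Compact
operators form an ideal, so all four operators `k * u`, `l`, `k`, `u * l` already lie in `ℂ1 +
K(H)`, although `u` itself may not. Both products therefore come from the free product over `ℂ1`,
and `λ` identifies them (`inl_compactElement_mul_inr`, `compactsFreeProductMap_compactElement_mul`).

Over `ℂ1` the two products can be told apart. Since only scalars are amalgamated, the identity on
the left factor and conjugation with any unitary `w` on the right factor fit together to a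
representation on `H` (`conjRep`). It sends the difference of the two products to `k * (u * w - w *
u) * l * star w`. A non-scalar `u` fails to commute with some unitary `w`, and suitable rank-one `k`
and `l` keep the commutator from being annihilated.

For the second claim, the elements of a Hilbert basis are grouped in pairs. Let `u` swap the members
of each pair, and let `v` be diagonal with opposite signs on them; then `u * u = 1` and `v * u = -(u
* v)`. Hence `C*(u)` is spanned by `1` and `u`. If `a1 + bu` differs from a scalar by a compact
operator, then conjugation with `v` reverses the sign of the `u`-term, so that `2bu`, and with it
`2b1`, is compact. In infinite dimension this forces `b = 0`. -/

theorem FullFreeProduct.inl_mul_inr {A B D : Type*} [NonUnitalCStarAlgebra A]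
    [NonUnitalCStarAlgebra B] [NonUnitalCStarAlgebra D] (φA : D →⋆ₙₐ[ℂ] A) (φB : D →⋆ₙₐ[ℂ] B)
    (a : A) (d : D) (b : B) :
    inl φA φB (a * φA d) * inr φA φB b = inl φA φB a * inr φA φB (φB d * b) := by
  have h : inl φA φB (φA d) = inr φA φB (φB d) :=
    DFunLike.congr_fun (inl_comp_eq_inr_comp φA φB) d
  rw [map_mul, map_mul, h, mul_assoc]

/-- The operator factors through `ℂ`, and a bounded functional is compact. -/
theorem isCompactOperator_rankOne {E : Type*} [NormedAddCommGroup E]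
    [InnerProductSpace ℂ E] (x y : E) :
    IsCompactOperator (InnerProductSpace.rankOne ℂ x y : E →L[ℂ] E) := by
  have h : IsCompactOperator (innerSL ℂ y : E →L[ℂ] ℂ) :=
    isCompactOperator_of_locallyCompactSpace_dom (innerSL ℂ y)
  exact h.clm_comp (ContinuousLinearMap.toSpanSingleton ℂ x)

/-- A nonzero operator remains nonzero after cutting down by suitable compact operators. -/
theorem exists_compact_mul_mul_ne_zero {E : Type*} [NormedAddCommGroup E]
    [InnerProductSpace ℂ E] {d : E →L[ℂ] E} (hd : d ≠ 0) :
    ∃ k l : E →L[ℂ] E, IsCompactOperator k ∧ IsCompactOperator l ∧ k * d * l ≠ 0 := by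
  obtain ⟨x, hx⟩ : ∃ x, d x ≠ 0 := by
    by_contra! h
    exact hd (ContinuousLinearMap.ext h)
  have hx0 : x ≠ 0 := by
    rintro rfl
    exact hx (map_zero d)
  -- With these choices `k * d * l` sends `x` to `‖x‖² ‖d x‖² • d x`.
  refine ⟨InnerProductSpace.rankOne ℂ (d x) (d x), InnerProductSpace.rankOne ℂ x x,
    isCompactOperator_rankOne _ _, isCompactOperator_rankOne _ _, fun h => ?_⟩
  have := DFunLike.congr_fun h x
  simp [hx, hx0] at this

/-! ### Failure of injectivity for every non-scalar `u` -/

section NotInjective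

variable {H : Type*} [NormedAddCommGroup H] [InnerProductSpace ℂ H] [CompleteSpace H]

/-- An operator that commutes with all unitaries is a scalar. -/
theorem mem_bot_of_forall_unitary_commute {u : H →L[ℂ] H}
    (h : ∀ w ∈ unitary (H →L[ℂ] H), u * w = w * u) :
    u ∈ (⊥ : StarSubalgebra ℂ (H →L[ℂ] H)) := by
  have hall : ∀ a : H →L[ℂ] H, a * u = u * a := by
    intro a
    -- Every operator is a linear combination of unitaries, so `u` is central, and the centre of
    -- `B(H)` is `ℂ1`.
    have ha : a ∈ Submodule.span ℂ (unitary (H →L[ℂ] H) : Set (H →L[ℂ] H)) := by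
      rw [CStarAlgebra.span_unitary]; trivial
    induction ha using Submodule.span_induction with
    | mem w hw => exact (h w hw).symm
    | zero => simp
    | add a b _ _ ha hb => rw [add_mul, mul_add, ha, hb]
    | smul c a _ ha => rw [smul_mul_assoc, mul_smul_comm, ha]
  have hc : u ∈ Subalgebra.center ℂ (H →L[ℂ] H) := Subalgebra.mem_center_iff.2 hall
  obtain ⟨c, hc⟩ := Algebra.mem_bot.1 (Algebra.IsCentral.out hc)
  exact StarSubalgebra.mem_bot.2 ⟨c, hc⟩

/-- The inclusion of a C⋆-subalgebra in `B(H)`. -/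
noncomputable def subtypeHom (S : StarSubalgebra ℂ (H →L[ℂ] H)) [IsClosed (S : Set (H →L[ℂ] H))] :
    CStarHom S (H →L[ℂ] H) :=
  S.subtype.toNonUnitalStarAlgHom

/-- The inclusion of a C⋆-subalgebra in `B(H)`, followed by conjugation with a unitary. -/
noncomputable def conjHom (S : StarSubalgebra ℂ (H →L[ℂ] H)) [IsClosed (S : Set (H →L[ℂ] H))]
    (w : unitary (H →L[ℂ] H)) : CStarHom S (H →L[ℂ] H) :=
  ((Unitary.conjStarAlgAut ℂ (H →L[ℂ] H) w).toStarAlgHom.comp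
    S.subtype).toNonUnitalStarAlgHom

/-- The representation of the free product over the scalars that is the identity on one factor and
conjugation with a unitary on the other. -/
noncomputable def conjRep (w : unitary (H →L[ℂ] H)) :
    CompactsFreeProduct (⊥ : StarSubalgebra ℂ (H →L[ℂ] H)) →⋆ₙₐ[ℂ] (H →L[ℂ] H) :=
  FullFreeProduct.lift (subtypeHom _) (conjHom _ w) (by
    -- Compatibility asks that `w` commute with the amalgamated algebra; for scalars this holds for
    -- every `w`.
    ext1 ⟨d, hd⟩
    obtain ⟨c, rfl⟩ := StarSubalgebra.mem_bot.1 hd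
    change algebraMap ℂ (H →L[ℂ] H) c = (w : H →L[ℂ] H) * algebraMap ℂ (H →L[ℂ] H) c *
      star (w : H →L[ℂ] H)
    rw [← Algebra.commutes, mul_assoc, Unitary.mul_star_self_of_mem w.2, mul_one])

/-- A compact operator, as an element of `S + K(H)`. -/
def compactElement (S : StarSubalgebra ℂ (H →L[ℂ] H)) {k : H →L[ℂ] H} (hk : IsCompactOperator k) :
    addCompacts S :=
  ⟨k, 0, zero_mem S, k, hk, (zero_add k).symm⟩

theorem conjRep_mul (w : unitary (H →L[ℂ] H))
    (a b : addCompacts (⊥ : StarSubalgebra ℂ (H →L[ℂ] H))) :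
    conjRep w (FullFreeProduct.inl _ _ a * FullFreeProduct.inr _ _ b) =
      (a : H →L[ℂ] H) * ((w : H →L[ℂ] H) * (b : H →L[ℂ] H) * star (w : H →L[ℂ] H)) :=
  (map_mul (conjRep w) _ _).trans
    (congrArg₂ (· * ·) (FullFreeProduct.lift_inl _ _ _ a) (FullFreeProduct.lift_inr _ _ _ b))

/-- Compact operators belong to both `S + K(H)` and `T + K(H)`, and the inclusion carries each to
itself. Through this, a relation among such products over `T` becomes a relation between images of
elements over `S`. -/
theorem compactsFreeProductMap_compactElement_mul {S T : StarSubalgebra ℂ (H →L[ℂ] H)}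
    [IsClosed (S : Set (H →L[ℂ] H))] [IsClosed (T : Set (H →L[ℂ] H))] (h : S ≤ T)
    {k l : H →L[ℂ] H} (hk : IsCompactOperator k) (hl : IsCompactOperator l) :
    compactsFreeProductMap h (FullFreeProduct.inl _ _ (compactElement S hk) *
        FullFreeProduct.inr _ _ (compactElement S hl)) =
      FullFreeProduct.inl (incl (le_addCompacts T)) (incl (le_addCompacts T))
          (compactElement T hk) *
        FullFreeProduct.inr _ _ (compactElement T hl) :=
  (map_mul (compactsFreeProductMap h) _ _).trans
    (congrArg₂ (· * ·) (FullFreeProduct.map_inl _ _ _ _ _ _) (FullFreeProduct.map_inr _ _ _ _ _ _))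

/-- Elements of `S` can be moved from one factor of the free product to the other. -/
theorem inl_compactElement_mul_inr {S : StarSubalgebra ℂ (H →L[ℂ] H)}
    [IsClosed (S : Set (H →L[ℂ] H))] {u k l : H →L[ℂ] H} (hu : u ∈ S) (hk : IsCompactOperator k)
    (hl : IsCompactOperator l) (hku : IsCompactOperator (k * u : H →L[ℂ] H))
    (hul : IsCompactOperator (u * l : H →L[ℂ] H)) :
    FullFreeProduct.inl (incl (le_addCompacts S)) (incl (le_addCompacts S))
          (compactElement S hku) *
        FullFreeProduct.inr _ _ (compactElement S hl) =
      FullFreeProduct.inl _ _ (compactElement S hk) *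
        FullFreeProduct.inr _ _ (compactElement S hul) := by
  let φ := incl (le_addCompacts S)
  -- Inside `S + K(H)` the compact operators `k * u` and `u * l` split off a factor from the
  -- amalgamated algebra.
  have e₁ : compactElement S hku = compactElement S hk * φ ⟨u, hu⟩ := Subtype.ext rfl
  have e₂ : compactElement S hul = φ ⟨u, hu⟩ * compactElement S hl := Subtype.ext rfl
  rw [e₁, e₂]
  exact FullFreeProduct.inl_mul_inr φ φ _ _ _

/-- A single non-scalar operator in `T` suffices: moving it across the product is possible over `T`,
while `conjRep` detects the move over `ℂ1`. -/
theorem not_injective_compactsFreeProductMap {T : StarSubalgebra ℂ (H →L[ℂ] H)}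
    [IsClosed (T : Set (H →L[ℂ] H))] {u : H →L[ℂ] H} (huT : u ∈ T)
    (hu : u ∉ (⊥ : StarSubalgebra ℂ (H →L[ℂ] H))) :
    ¬ Function.Injective (compactsFreeProductMap
      (bot_le : (⊥ : StarSubalgebra ℂ (H →L[ℂ] H)) ≤ T)) := by
  intro hinj
  obtain ⟨w, hw, hne⟩ : ∃ w ∈ unitary (H →L[ℂ] H), u * w ≠ w * u := by
    by_contra! h
    exact hu (mem_bot_of_forall_unitary_commute h)
  obtain ⟨k, l, hk, hl, hkl⟩ := exists_compact_mul_mul_ne_zero (sub_ne_zero.2 hne)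
  have hku : IsCompactOperator (k * u : H →L[ℂ] H) := compact_mul_right u k hk
  have hul : IsCompactOperator (u * l : H →L[ℂ] H) := compact_mul_left u l hl
  -- Both elements have the same image because `u` lies in `T`; injectivity would make them equal
  -- already over `ℂ1`.
  have heq := hinj ((compactsFreeProductMap_compactElement_mul bot_le hku hl).trans
    ((inl_compactElement_mul_inr huT hk hl hku hul).trans
      (compactsFreeProductMap_compactElement_mul bot_le hk hul).symm))
  have hrep := congrArg (conjRep ⟨w, hw⟩) heq
  rw [conjRep_mul, conjRep_mul] at hrep
  change k * u * (w * l * star w) = k * (w * (u * l) * star w) at hrep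
  have hww : star w * w = 1 := Unitary.star_mul_self_of_mem hw
  refine hkl ?_
  -- Multiplication by `w` on the right cancels the trailing `star w` left by the conjugation.
  calc k * (u * w - w * u) * l
      = (k * u * (w * l * star w) - k * (w * (u * l) * star w)) * w := by
        simp only [sub_mul, mul_sub, mul_assoc, hww, mul_one]
    _ = 0 := by rw [hrep, sub_self, zero_mul]

end NotInjective

/-! ### A non-scalar unitary whose C⋆-algebra meets `ℂ1 + K(H)` only in the scalars -/

section TrivialIntersection

variable {H : Type*} [NormedAddCommGroup H] [InnerProductSpace ℂ H] [CompleteSpace H]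

/-- The isometry that permutes the elements of a Hilbert basis and multiplies them by scalars of
modulus one. -/
theorem HilbertBasis.exists_isometry_perm {ι : Type*} (b : HilbertBasis ι ℂ H)
    (σ : Equiv.Perm ι) (ε : ι → ℂ) (hε : ∀ i, ‖ε i‖ = 1) :
    ∃ U ∈ unitary (H →L[ℂ] H), ∀ i, U (b i) = ε i • b (σ i) := by
  classical
  have hε0 : ∀ i, ε i ≠ 0 := fun i h => by simpa [h] using hε i
  -- The prescribed images form a Hilbert basis again; the operator is the change of basis from `b`
  -- to it.
  have ho : Orthonormal ℂ fun i => ε i • b (σ i) := by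
    rw [orthonormal_iff_ite]
    intro i j
    rw [inner_smul_left, inner_smul_right, orthonormal_iff_ite.1 b.orthonormal]
    by_cases hij : i = j
    · subst hij
      simp [RCLike.conj_mul, hε]
    · simp [hij]
  have hs : (⊤ : Submodule ℂ H) ≤
      (Submodule.span ℂ (Set.range fun i => ε i • b (σ i))).topologicalClosure := by
    rw [← b.dense_span]
    refine Submodule.topologicalClosure_mono (Submodule.span_le.2 ?_)
    rintro _ ⟨i, rfl⟩
    -- The vector `b i` is recovered from the new vector with index `σ.symm i` by dividing out its
    -- scalar.
    have h := Submodule.smul_mem _ (ε (σ.symm i))⁻¹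
      (Submodule.subset_span (R := ℂ) (Set.mem_range_self (f := fun i => ε i • b (σ i)) (σ.symm i)))
    simpa [smul_smul, hε0] using h
  let b' := HilbertBasis.mk ho hs
  let e : H ≃ₗᵢ[ℂ] H := b.repr.trans b'.repr.symm
  refine ⟨Unitary.linearIsometryEquiv.symm e, (Unitary.linearIsometryEquiv.symm e).2, fun i => ?_⟩
  have hb' : b' i = ε i • b (σ i) := congrFun (HilbertBasis.coe_mk ho hs) i
  rw [← hb', ← b'.repr_symm_single]
  change b'.repr.symm (b.repr (b i)) = _
  rw [b.repr_self]

theorem HilbertBasis.clm_ext {ι E F : Type*} [NormedAddCommGroup E] [InnerProductSpace ℂ E]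
    [NormedAddCommGroup F] [NormedSpace ℂ F] (b : HilbertBasis ι ℂ E) {S T : E →L[ℂ] F}
    (h : ∀ i, S (b i) = T (b i)) : S = T := by
  refine ContinuousLinearMap.ext_on (s := Set.range b) ?_ ?_
  · exact Submodule.dense_iff_topologicalClosure_eq_top.2 b.dense_span
  · rintro _ ⟨i, rfl⟩
    exact h i

/-- On an infinite-dimensional Hilbert space there are two anticommuting unitaries, one of which is
an involution. -/
theorem exists_anticommuting_unitaries (hH : ¬ FiniteDimensional ℂ H) :
    ∃ u ∈ unitary (H →L[ℂ] H), ∃ v ∈ unitary (H →L[ℂ] H), u * u = 1 ∧ v * u = -(u * v) := by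
  obtain ⟨s, b, -⟩ := exists_hilbertBasis ℂ H
  have hs : Infinite s := by
    by_contra hfin
    rw [not_infinite_iff_finite] at hfin
    have := Fintype.ofFinite s
    exact hH b.toOrthonormalBasis.toBasis.finiteDimensional_of_finite
  -- An infinite cardinal is unchanged by doubling, so the basis can be grouped in pairs.
  obtain ⟨e⟩ : Nonempty (s ≃ s × Bool) := by
    refine Cardinal.eq.1 ?_
    rw [Cardinal.mk_prod, Cardinal.lift_uzero, Cardinal.mk_bool, Cardinal.lift_two]
    exact (Cardinal.mul_eq_left (Cardinal.aleph0_le_mk s)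
      (Cardinal.ofNat_lt_aleph0.le.trans (Cardinal.aleph0_le_mk s)) two_ne_zero).symm
  -- `σ` swaps the two members of each pair and `ε` gives them opposite signs. Thus `σ` is an
  -- involution that reverses `ε`, which makes the permutation operator `u` and the diagonal
  -- operator `v` anticommute.
  let σ : Equiv.Perm s := e.trans ((Equiv.prodCongr (Equiv.refl s) Equiv.boolNot).trans e.symm)
  let ε : s → ℂ := fun i => if (e i).2 then 1 else -1
  have hσσ : ∀ i, σ (σ i) = i := fun i => by
    simp [σ, e.symm_apply_eq, Prod.ext_iff]
  have hεσ : ∀ i, ε (σ i) = -ε i := fun i => by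
    simp only [ε, σ]
    cases h : (e i).2 <;> simp [h]
  obtain ⟨u, hu, hub⟩ := b.exists_isometry_perm σ 1 (by simp)
  obtain ⟨v, hv, hvb⟩ := b.exists_isometry_perm (Equiv.refl s) ε (fun i => by
    simp only [ε]; split_ifs <;> simp)
  refine ⟨u, hu, v, hv, b.clm_ext fun i => ?_, b.clm_ext fun i => ?_⟩
  · simp [hub, hσσ]
  · simp [hub, hvb, hεσ]

/-- The C⋆-algebra generated by a selfadjoint involution. -/
theorem exists_of_mem_elemental {u : H →L[ℂ] H} (hu : star u = u) (huu : u * u = 1)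
    {x : H →L[ℂ] H} (hx : x ∈ StarAlgebra.elemental ℂ u) :
    ∃ a b : ℂ, x = a • (1 : H →L[ℂ] H) + b • u := by
  have hmem : ∀ x : H →L[ℂ] H, x ∈ Submodule.span ℂ {(1 : H →L[ℂ] H), u} ↔
      ∃ a b : ℂ, a • (1 : H →L[ℂ] H) + b • u = x := fun x => Submodule.mem_span_pair
  -- By `u * u = 1` and `star u = u`, the span of `1` and `u` is already a ⋆-algebra; being
  -- finite-dimensional it is closed, so it contains `C*(u)`.
  let S : StarSubalgebra ℂ (H →L[ℂ] H) :=
    { carrier := Submodule.span ℂ {(1 : H →L[ℂ] H), u}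
      mul_mem' := by
        intro x y hx hy
        obtain ⟨a, b, rfl⟩ := (hmem x).1 hx
        obtain ⟨c, d, rfl⟩ := (hmem y).1 hy
        refine (hmem _).2 ⟨a * c + b * d, a * d + b * c, ?_⟩
        simp only [add_mul, mul_add, smul_mul_smul_comm, huu, one_mul, mul_one, add_smul]
        abel
      add_mem' := add_mem
      algebraMap_mem' := fun c => (hmem _).2 ⟨c, 0, by simp [Algebra.algebraMap_eq_smul_one]⟩
      star_mem' := by
        intro x hx
        obtain ⟨a, b, rfl⟩ := (hmem x).1 hx
        exact (hmem _).2 ⟨star a, star b, by simp [hu]⟩ }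
  have : FiniteDimensional ℂ (Submodule.span ℂ {(1 : H →L[ℂ] H), u}) :=
    FiniteDimensional.span_of_finite ℂ (Set.toFinite _)
  have hS : IsClosed (S : Set (H →L[ℂ] H)) := Submodule.closed_of_finiteDimensional
    (Submodule.span ℂ {(1 : H →L[ℂ] H), u})
  obtain ⟨a, b, h⟩ := (hmem x).1 (StarAlgebra.elemental.le_of_mem hS
    (Submodule.subset_span (by simp) : u ∈ Submodule.span ℂ {(1 : H →L[ℂ] H), u}) hx)
  exact ⟨a, b, h.symm⟩

/-- Otherwise division by `c` would make the identity compact, which by Riesz happens only in finite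
dimension. -/
theorem eq_zero_of_isCompactOperator_smul_one {E : Type*} [NormedAddCommGroup E]
    [NormedSpace ℂ E] (hE : ¬ FiniteDimensional ℂ E) {c : ℂ}
    (hc : IsCompactOperator (c • (1 : E →L[ℂ] E))) : c = 0 := by
  by_contra h
  refine hE (isCompactOperator_id_iff_finiteDimensional.1 ?_)
  have h' : c⁻¹ • ⇑(c • (1 : E →L[ℂ] E)) = id := by
    funext x
    simp [smul_smul, h]
  exact h' ▸ hc.smul c⁻¹

/-- If a linear combination of `1` and `u` is compact, where `u` is a unitary that anticommutes with
a unitary, then it is zero. -/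
theorem eq_zero_of_isCompactOperator_add (hH : ¬ FiniteDimensional ℂ H) {u v : H →L[ℂ] H}
    (huu : u * u = 1) (hv : v ∈ unitary (H →L[ℂ] H)) (hvu : v * u = -(u * v)) {a b : ℂ}
    (hc : IsCompactOperator (a • (1 : H →L[ℂ] H) + b • u)) : b = 0 := by
  have hvv : v * star v = 1 := Unitary.mul_star_self_of_mem hv
  -- Conjugation with `v` preserves compactness and reverses the sign of `u`, so subtraction
  -- isolates `2bu`.
  have h1 : v * (a • (1 : H →L[ℂ] H) + b • u) * star v = a • 1 - b • u := by
    simp [mul_add, add_mul, hvu, mul_assoc, hvv, sub_eq_add_neg]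
  have h2 := compact_mul_right (star v) _ (compact_mul_left v _ hc)
  rw [h1] at h2
  have h3 : IsCompactOperator (a • (1 : H →L[ℂ] H) + b • u - (a • 1 - b • u) : H →L[ℂ] H) :=
    hc.sub h2
  have h4 := compact_mul_right u _ h3
  -- A further factor `u` turns `2bu` into a multiple of the identity.
  have h5 : (a • (1 : H →L[ℂ] H) + b • u - (a • 1 - b • u)) * u = (2 * b) • 1 := by
    rw [add_sub_sub_cancel, ← two_smul ℂ (b • u), smul_smul, smul_mul_assoc, huu]
  rw [h5] at h4
  exact (mul_eq_zero.1 (eq_zero_of_isCompactOperator_smul_one hH h4)).resolve_left two_ne_zero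

theorem addCompacts_bot_inf_elemental (hH : ¬ FiniteDimensional ℂ H) {u v : H →L[ℂ] H}
    (hu : u ∈ unitary (H →L[ℂ] H)) (huu : u * u = 1) (hv : v ∈ unitary (H →L[ℂ] H))
    (hvu : v * u = -(u * v)) :
    addCompacts (⊥ : StarSubalgebra ℂ (H →L[ℂ] H)) ⊓ StarAlgebra.elemental ℂ u = ⊥ := by
  have hsu : star u = u := by
    calc star u = star u * (u * u) := by rw [huu, mul_one]
      _ = u := by rw [← mul_assoc, Unitary.star_mul_self_of_mem hu, one_mul]
  refine eq_bot_iff.2 fun x hx => ?_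
  obtain ⟨⟨s, hs, k, hk, hxk⟩, hxu⟩ := StarSubalgebra.mem_inf.1 hx
  obtain ⟨c, rfl⟩ := StarSubalgebra.mem_bot.1 hs
  obtain ⟨a, b, rfl⟩ := exists_of_mem_elemental hsu huu hxu
  -- Comparing `a1 + bu` with `c1 + k` shows that this combination is compact. Only `b = 0` is
  -- needed from it, since `x` is then the scalar `a`.
  have hk' : k = (a - c) • (1 : H →L[ℂ] H) + b • u := by
    rw [eq_sub_of_add_eq' hxk.symm, Algebra.algebraMap_eq_smul_one, sub_smul]
    abel
  rw [hk'] at hk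
  rw [eq_zero_of_isCompactOperator_add hH huu hv hvu hk, zero_smul, add_zero,
    ← Algebra.algebraMap_eq_smul_one]
  exact algebraMap_mem _ a

/-- A scalar commutes with `v`; together with anticommutation this gives `u * v = 0`, impossible for
a product of unitaries on a nonzero space. -/
theorem notMem_bot_of_anticommute [Nontrivial H] {u v : H →L[ℂ] H}
    (hu : u ∈ unitary (H →L[ℂ] H)) (hv : v ∈ unitary (H →L[ℂ] H)) (hvu : v * u = -(u * v)) :
    u ∉ (⊥ : StarSubalgebra ℂ (H →L[ℂ] H)) := by
  intro h
  obtain ⟨c, rfl⟩ := StarSubalgebra.mem_bot.1 h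
  rw [← Algebra.commutes, eq_neg_iff_add_eq_zero, ← two_smul ℂ, smul_eq_zero,
    or_iff_right two_ne_zero] at hvu
  have h1 := (mul_mem hu hv).1
  rw [hvu, mul_zero] at h1
  exact zero_ne_one h1

end TrivialIntersection

theorem mainTheorem7 {H : Type*} [NormedAddCommGroup H] [InnerProductSpace ℂ H] [CompleteSpace H]
    [TopologicalSpace.SeparableSpace H] (hH : ¬ FiniteDimensional ℂ H) :
    (∀ u ∈ unitary (H →L[ℂ] H), u ∉ (⊥ : StarSubalgebra ℂ (H →L[ℂ] H)) →
      ¬ Function.Injective (compactsFreeProductMap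
        (bot_le : (⊥ : StarSubalgebra ℂ (H →L[ℂ] H)) ≤ StarAlgebra.elemental ℂ u))) ∧
    (∃ u ∈ unitary (H →L[ℂ] H), u ∉ (⊥ : StarSubalgebra ℂ (H →L[ℂ] H)) ∧
      addCompacts (⊥ : StarSubalgebra ℂ (H →L[ℂ] H)) ⊓ StarAlgebra.elemental ℂ u = ⊥) := by
  refine ⟨fun u _ hu =>
    not_injective_compactsFreeProductMap (StarAlgebra.elemental.self_mem ℂ u) hu, ?_⟩
  obtain ⟨u, hu, v, hv, huu, hvu⟩ := exists_anticommuting_unitaries hH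
  have : Nontrivial H := by
    by_contra h
    rw [not_nontrivial_iff_subsingleton] at h
    exact hH inferInstance
  exact ⟨u, hu, notMem_bot_of_anticommute hu hv hvu, addCompacts_bot_inf_elemental hH hu huu hv hvu⟩
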